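/- **Definitions.** A *pseudo-effect algebra* (PEA) is a structure $(E;+,0,1)$ with a partial binary operation $+$ such that for all $a,b,c\in E$: (PE1) $a+b$ and $(a+b)+c$ exist iff $b+c$ and $a+(b+c)$ exist, and then $(a+b)+c=a+(b+c)$; (PE2) there are exactly one $d$ and exactly one $e$ with $a+d=e+a=1$; we write $a^{\sim}=d$, $a^{-}=e$; (PE3) if $a+b$ exists, there are $d,e$ with $a+b=d+a=b+e$; (PE4) if $a+1$ or $1+a$ exists, then $a=0$. Put $a\le b$ iff $a+c=b$ for some $c$; $0a=0$ and $(k+1)a=ka+a$ whenever this exists. $E$ is *symmetric* if $a^-=a^\sim$ for all $a$. An *ideal* is a nonempty $I\subseteq E$ that is closed downwards and closed under existing sums; it is *maximal* if $1\notin I$ and no other ideal not containing $1$ includes it. $E$ satisfies *(RDP)$_1$* if, whenever $a_1+a_2=b_1+b_2$ (both sums existing), there are $c_{11},c_{12},c_{21},c_{22}\in E$ with $a_1=c_{11}+c_{12}$, $a_2=c_{21}+c_{22}$, $b_1=c_{11}+c_{21}$, $b_2=c_{12}+c_{22}$, and for all $x\le c_{12}$, $y\le c_{21}$ both $x+y$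 and $y+x$ exist and are equal. A *state* on $E$ is a map $s:E\to[0,1]$ with $s(0)=0$, $s(1)=1$ and $s(a+b)=s(a)+s(b)$ whenever $a+b$ exists. It is *extremal* if $s=\alpha s_1+(1-\alpha)s_2$ with states $s_1,s_2$ and $\alpha\in(0,1)$ implies $s=s_1=s_2$. Let $n\ge 1$. An *$n$-decomposition* of $E$ is a tuple $(E_0,\dots,E_n)$ of nonempty, pairwise disjoint subsets with union $E$ such that $E_i^-=E_i^\sim=E_{n-i}$ for all $i$ (where $A^-=\{a^-:a\in A\}$, $A^\sim=\{a^\sim:a\in A\}$), and such that if $x\in E_i$, $y\in E_j$ and $x+y$ exists, then $i+j\le n$ and $x+y\in E_{i+j}$. $E$ is *$n$-perfect* if it has an $n$-decomposition such that $x+y$ exists whenever $x\in E_i$, $y\in E_j$, $i+j<n$, and such that $E_0$ is the unique maximal ideal of $E$. A *unital po-group* $(H,u)$ is a (not necessarily Abelian) additive group $H$ with a translation-invariant partial order and a strong unit $u$, i.e. $u\ge 0$ and every $g\in H$ satisfies $g\le ku$ for some integer $k\ge1$. It is *torsion-free* if $kg\neq 0$ for all $g\ne 0$ and all nonzero integers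 $k$. $\Gamma(H,u)$ is the PEA $\{x\in H: 0\le x\le u\}$ with unit $u$, where $a+b$ is defined iff $a\le u-b$ and is then the sum in $H$. An $n$-perfect PEA $E$ satisfying (RDP)$_1$ is *strong $n$-perfect* if there are a torsion-free unital po-group $(H,u)$ with $E=\Gamma(H,u)$ (up to isomorphism of PEAs) and an element $c\in E_1$ with $nc=u$ and $c+x=x+c$ for all $x\in H$, where $E_1$ belongs to an $n$-decomposition as in the definition of $n$-perfect. Every $c\in E$ that arises in this way, for some $(H,u)$, is called a *strong cyclic element of order $n$*. **Statement.** Let $n\ge 1$ and let $E$ be a strong $n$-perfect PEA. Then: (i) $E$ has a unique strong cyclic element of order $n$. (ii) $E$ has a unique $n$-decomposition $(E_0,\dots,E_n)$. (iii) There is a state $s$ on $E$ with $s(E_i)=\{i/n\}$ for $i=0,\dots,n$; it is the only state on $E$, and it is extremal. (iv) $E$ is symmetric. -/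

import Mathlib

universe u v

/-- A pseudo-effect algebra `(E; +, 0, 1)`. The partial operation is `padd`:
`padd a b = some c` means that `a + b` exists and equals `c`, and `padd a b = none` means
that `a + b` does not exist. -/
class PseudoEffectAlgebra (E : Type u) extends Zero E, One E where
  padd : E → E → Option E
  /-- `a + b` and `(a + b) + c` exist iff `b + c` and `a + (b + c)` exist, and then
  both sums have the same value. -/
  assoc : ∀ a b c e : E, (∃ d, padd a b = some d ∧ padd d c = some e) ↔
    (∃ d, padd b c = some d ∧ padd a d = some e)
  exists_unique_right : ∀ a : E, ∃! d, padd a d = some 1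
  exists_unique_left : ∀ a : E, ∃! e, padd e a = some 1
  conj : ∀ a b c : E, padd a b = some c →
    (∃ d, padd d a = some c) ∧ (∃ e, padd b e = some c)
  eq_zero_of_add_one : ∀ a : E,
    ((∃ c, padd a 1 = some c) ∨ (∃ c, padd 1 a = some c)) → a = 0

namespace PseudoEffectAlgebra

section Basic

variable {E : Type u} [PseudoEffectAlgebra E]

/-- `a + b` exists. -/
def Summable (a b : E) : Prop := ∃ c, padd a b = some c

/-- `a ≤ b` iff `a + c = b` for some `c`. -/
def Le (a b : E) : Prop := ∃ c, padd a c = some b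

/-- `a⁻`, the unique element with `a⁻ + a = 1`. -/
noncomputable def lneg (a : E) : E := Classical.choose (exists_unique_left a)

/-- `a˜`, the unique element with `a + a˜ = 1`. -/
noncomputable def rneg (a : E) : E := Classical.choose (exists_unique_right a)

/-- The partial multiple `n a`: `0 a = 0` and `(n + 1) a = n a + a`. -/
def nmul : ℕ → E → Option E
  | 0, _ => some 0
  | n + 1, a => (nmul n a).bind (fun b => padd b a)

variable (E) in
/-- `E` is symmetric: `a⁻ = a˜` for all `a`. -/
def IsSymmetric : Prop := ∀ a : E, lneg a = rneg a

variable (E) in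
/-- The Riesz Decomposition Property (RDP)₁. -/
def RDP1 : Prop := ∀ a₁ a₂ b₁ b₂ s : E, padd a₁ a₂ = some s → padd b₁ b₂ = some s →
  ∃ c₁₁ c₁₂ c₂₁ c₂₂ : E,
    padd c₁₁ c₁₂ = some a₁ ∧ padd c₂₁ c₂₂ = some a₂ ∧
    padd c₁₁ c₂₁ = some b₁ ∧ padd c₁₂ c₂₂ = some b₂ ∧
    ∀ x y : E, Le x c₁₂ → Le y c₂₁ → ∃ z, padd x y = some z ∧ padd y x = some z

/-- Ideals of a pseudo-effect algebra. -/
structure IsIdeal (I : Set E) : Prop where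
  nonempty : I.Nonempty
  down : ∀ a i : E, i ∈ I → Le a i → a ∈ I
  add : ∀ i j k : E, i ∈ I → j ∈ I → padd i j = some k → k ∈ I

/-- Maximal ideals: proper ideals not properly included in any proper ideal. -/
structure IsMaximalIdeal (I : Set E) : Prop where
  ideal : IsIdeal I
  proper : (1 : E) ∉ I
  maximal : ∀ J : Set E, IsIdeal J → (1 : E) ∉ J → I ⊆ J → J = I

/-- `(D 0, …, D n)` is an `n`-decomposition of `E`. -/
structure IsDecomposition (n : ℕ) (D : Fin (n + 1) → Set E) : Prop where
  nonempty : ∀ i, (D i).Nonempty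
  disjoint : ∀ i j, i ≠ j → D i ∩ D j = ∅
  cover : (⋃ i, D i) = Set.univ
  /-- `(E_i)⁻ = (E_i)˜ = E_{n - i}`. -/
  image_lneg : ∀ i, lneg '' D i = D i.rev
  image_rneg : ∀ i, rneg '' D i = D i.rev
  /-- If `x ∈ E_i`, `y ∈ E_j` and `x + y` exists, then `i + j ≤ n` and `x + y ∈ E_{i+j}`. -/
  add_mem : ∀ (i j : Fin (n + 1)) (x y z : E), x ∈ D i → y ∈ D j → padd x y = some z →
    ∃ h : (i : ℕ) + (j : ℕ) ≤ n, z ∈ D ⟨(i : ℕ) + (j : ℕ), Nat.lt_succ_of_le h⟩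

/-- `(D 0, …, D n)` is an `n`-decomposition as required in the definition of an
`n`-perfect pseudo-effect algebra. -/
structure IsPerfectDecomposition (n : ℕ) (D : Fin (n + 1) → Set E) : Prop where
  decomposition : IsDecomposition n D
  summable : ∀ (i j : Fin (n + 1)) (x y : E), (i : ℕ) + (j : ℕ) < n →
    x ∈ D i → y ∈ D j → Summable x y
  maximal : IsMaximalIdeal (D 0)
  unique : ∀ I : Set E, IsMaximalIdeal I → I = D 0

variable (E) in
/-- `E` is an `n`-perfect pseudo-effect algebra. -/
def IsPerfect (n : ℕ) : Prop := ∃ D : Fin (n + 1) → Set E, IsPerfectDecomposition n D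

/-- States: morphisms from `E` into the interval pseudo-effect algebra `[0,1]` of the
reals. A sum of two values exists in `[0,1]` iff it is at most `1`. -/
structure IsState (s : E → ℝ) : Prop where
  mem_Icc : ∀ x, s x ∈ Set.Icc (0 : ℝ) 1
  map_zero : s 0 = 0
  map_one : s 1 = 1
  map_add : ∀ a b c : E, padd a b = some c → s a + s b ≤ 1 ∧ s c = s a + s b

/-- Extremal states. -/
def IsExtremal (s : E → ℝ) : Prop :=
  IsState s ∧ ∀ (s₁ s₂ : E → ℝ) (α : ℝ), IsState s₁ → IsState s₂ → α ∈ Set.Ioo (0 : ℝ) 1 →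
    (∀ x, s x = α * s₁ x + (1 - α) * s₂ x) → s = s₁ ∧ s = s₂

/-- Isomorphisms of pseudo-effect algebras: bijections that preserve `0`, `1` and, in
both directions, the existence and the value of sums. -/
structure IsIso {F : Type v} [PseudoEffectAlgebra F] (f : E → F) : Prop where
  bijective : Function.Bijective f
  map_zero : f 0 = 0
  map_one : f 1 = 1
  map_padd : ∀ a b c : E, padd a b = some c ↔ padd (f a) (f b) = some (f c)

end Basic

end PseudoEffectAlgebra

/-- A unital po-group `(H, u)`: a (not necessarily commutative) partially ordered group,
written additively, with a strong unit `u`. -/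
structure UnitalPoGroup where
  carrier : Type u
  group : AddGroup carrier
  order : PartialOrder carrier
  add_le_add : ∀ a b c d : carrier, a ≤ b → c + a + d ≤ c + b + d
  unit : carrier
  unit_nonneg : 0 ≤ unit
  strong : ∀ g : carrier, ∃ n : ℕ, 1 ≤ n ∧ g ≤ n • unit

namespace UnitalPoGroup

instance (H : UnitalPoGroup.{u}) : AddGroup H.carrier := H.group

instance (H : UnitalPoGroup.{u}) : PartialOrder H.carrier := H.order

instance (H : UnitalPoGroup.{u}) : AddLeftMono H.carrier :=
  ⟨fun c a b h => by simpa using H.add_le_add a b c 0 h⟩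

instance (H : UnitalPoGroup.{u}) : AddRightMono H.carrier :=
  ⟨fun c a b h => by simpa using H.add_le_add a b 0 c h⟩

/-- `n g ≠ 0` for every `g ≠ 0` and every nonzero integer `n`. -/
def IsTorsionFree (H : UnitalPoGroup.{u}) : Prop :=
  ∀ (g : H.carrier) (n : ℤ), g ≠ 0 → n ≠ 0 → n • g ≠ 0

/-- The set `Γ(H, u) = {x ∈ H ∣ 0 ≤ x ≤ u}`. -/
def Gamma (H : UnitalPoGroup.{u}) : Type u := {x : H.carrier // 0 ≤ x ∧ x ≤ H.unit}

/-- The partial addition of `Γ(H, u)`: `a + b` is defined iff `a ≤ u - b`, and is then the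
sum in `H`. -/
noncomputable def Gamma.padd {H : UnitalPoGroup.{u}} (a b : H.Gamma) : Option H.Gamma :=
  open Classical in
  if h : a.1 ≤ H.unit - b.1 then
    some ⟨a.1 + b.1, add_nonneg a.2.1 b.2.1, le_sub_iff_add_le.mp h⟩
  else none

theorem Gamma.padd_eq_some {H : UnitalPoGroup.{u}} (a b c : H.Gamma) :
    Gamma.padd a b = some c ↔ a.1 + b.1 = c.1 := by
  unfold Gamma.padd
  constructor
  · intro h
    split_ifs at h
    exact congrArg Subtype.val (Option.some.inj h)
  · intro h
    have h1 : a.1 ≤ H.unit - b.1 := by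
      rw [le_sub_iff_add_le, h]
      exact c.2.2
    rw [dif_pos h1]
    exact congrArg some (Subtype.ext h)

/-- `(Γ(H, u); +, 0, u)` is a pseudo-effect algebra. -/
noncomputable instance (H : UnitalPoGroup.{u}) : PseudoEffectAlgebra H.Gamma where
  zero := ⟨0, le_rfl, H.unit_nonneg⟩
  one := ⟨H.unit, H.unit_nonneg, le_rfl⟩
  padd := Gamma.padd
  assoc a b c e := by
    simp only [Gamma.padd_eq_some]
    constructor
    · rintro ⟨d, h1, h2⟩
      have h3 : a.1 + (b.1 + c.1) = e.1 := by rw [← add_assoc, h1, h2]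
      refine ⟨⟨b.1 + c.1, add_nonneg b.2.1 c.2.1, ?_⟩, rfl, h3⟩
      exact (le_add_of_nonneg_left a.2.1).trans (h3.le.trans e.2.2)
    · rintro ⟨d, h1, h2⟩
      have h3 : a.1 + b.1 + c.1 = e.1 := by rw [add_assoc, h1, h2]
      refine ⟨⟨a.1 + b.1, add_nonneg a.2.1 b.2.1, ?_⟩, rfl, h3⟩
      exact (le_add_of_nonneg_right c.2.1).trans (h3.le.trans e.2.2)
  exists_unique_right a := by
    simp only [Gamma.padd_eq_some]
    refine ⟨⟨-a.1 + H.unit, ?_, ?_⟩, add_neg_cancel_left a.1 H.unit, ?_⟩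
    · exact le_neg_add_iff_add_le.mpr (by simpa using a.2.2)
    · exact neg_add_le_iff_le_add.mpr (le_add_of_nonneg_left a.2.1)
    · intro d hd
      exact Subtype.ext (eq_neg_add_of_add_eq hd)
  exists_unique_left a := by
    simp only [Gamma.padd_eq_some]
    refine ⟨⟨H.unit - a.1, sub_nonneg.mpr a.2.2, ?_⟩, sub_add_cancel H.unit a.1, ?_⟩
    · exact sub_le_iff_le_add.mpr (le_add_of_nonneg_right a.2.1)
    · intro d hd
      exact Subtype.ext (eq_sub_of_add_eq hd)
  conj a b c h := by
    simp only [Gamma.padd_eq_some] at h ⊢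
    refine ⟨⟨⟨c.1 - a.1, ?_, ?_⟩, sub_add_cancel c.1 a.1⟩,
      ⟨⟨-b.1 + c.1, ?_, ?_⟩, add_neg_cancel_left b.1 c.1⟩⟩
    · rw [sub_nonneg, ← h]
      exact le_add_of_nonneg_right b.2.1
    · exact (sub_le_iff_le_add.mpr (le_add_of_nonneg_right a.2.1)).trans c.2.2
    · rw [le_neg_add_iff_add_le, add_zero, ← h]
      exact le_add_of_nonneg_left a.2.1
    · exact (neg_add_le_iff_le_add.mpr (le_add_of_nonneg_left b.2.1)).trans c.2.2
  eq_zero_of_add_one a h := by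
    simp only [Gamma.padd_eq_some] at h
    apply Subtype.ext
    change a.1 = 0
    refine le_antisymm ?_ a.2.1
    rcases h with ⟨c, hc⟩ | ⟨c, hc⟩
    · have h1 : a.1 + H.unit ≤ H.unit := hc.le.trans c.2.2
      simpa using h1
    · have h1 : H.unit + a.1 ≤ H.unit := hc.le.trans c.2.2
      simpa using h1

end UnitalPoGroup

namespace PseudoEffectAlgebra

/-- `c` is a strong cyclic element of order `n` of the `n`-perfect pseudo-effect algebra
`E`: for some identification `φ` of `E` with `Γ(H, u)`, where `(H, u)` is a torsion-free
unital po-group, `c ∈ E_1`, `n c = u`, and `c` commutes with all elements of `H`. -/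
def IsStrongCyclic {E : Type u} [PseudoEffectAlgebra E] (n : ℕ) (c : E) : Prop :=
  ∃ (H : UnitalPoGroup.{u}) (φ : E → H.Gamma),
    H.IsTorsionFree ∧ IsIso φ ∧
    (∃ (D : Fin (n + 1) → Set E) (i : Fin (n + 1)),
      IsPerfectDecomposition n D ∧ (i : ℕ) = 1 ∧ c ∈ D i) ∧
    nmul n c = some 1 ∧
    ∀ x : H.carrier, x + (φ c).1 = (φ c).1 + x

/-- `E` is a strong `n`-perfect pseudo-effect algebra. -/
def IsStrongPerfect (E : Type u) [PseudoEffectAlgebra E] (n : ℕ) : Prop :=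
  IsPerfect E n ∧ RDP1 E ∧ ∃ c : E, IsStrongCyclic n c

end PseudoEffectAlgebra

namespace PseudoEffectAlgebra

variable {E : Type u} [PseudoEffectAlgebra E]

/-! Everything about states and decompositions reduces to one computation: any state `t` takes the
value `i / n` on the `i`-th part of a perfect decomposition (`state_eq`). It vanishes on `D 0`. For
`x` in `D i`, Riesz decomposition of `x + x˜ = c + ⋯ + c` splits `x` into pieces of `c`, each of
value `0` or `t c` according to its index, and `n · t c = 1`. So there is at most one state, which
is then extremal. Every decomposition yields a state from its index function (`exists_state`), so
uniqueness of the state forces uniqueness of the decomposition. Uniqueness of the cyclic element and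
symmetry are instead read off in `H`, where `c` is central. -/

theorem padd_rneg (a : E) : padd a (rneg a) = some 1 :=
  (Classical.choose_spec (exists_unique_right a)).1

theorem lneg_padd (a : E) : padd (lneg a) a = some 1 :=
  (Classical.choose_spec (exists_unique_left a)).1

theorem eq_rneg {a d : E} (h : padd a d = some 1) : d = rneg a :=
  (Classical.choose_spec (exists_unique_right a)).2 d h

theorem eq_lneg {a e : E} (h : padd e a = some 1) : e = lneg a :=
  (Classical.choose_spec (exists_unique_left a)).2 e h

theorem lneg_one : lneg (1 : E) = 0 :=
  eq_zero_of_add_one _ (Or.inl ⟨1, lneg_padd 1⟩)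

theorem zero_padd_one : padd (0 : E) 1 = some 1 := by
  simpa only [lneg_one] using lneg_padd (1 : E)

theorem rneg_zero : rneg (0 : E) = 1 := (eq_rneg zero_padd_one).symm

/-- Reassociating `0 + (a + a˜) = 1` makes both `0 + a` and `a` left complements of `a˜`. -/
theorem zero_padd (a : E) : padd 0 a = some a := by
  obtain ⟨d, h1, h2⟩ := (assoc 0 a (rneg a) 1).2 ⟨1, padd_rneg a, zero_padd_one⟩
  rw [h1, eq_lneg h2, ← eq_lneg (padd_rneg a)]

theorem nmul_succ_eq_some {k : ℕ} {c b : E} :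
    nmul (k + 1) c = some b ↔ ∃ a, nmul k c = some a ∧ padd a c = some b :=
  Option.bind_eq_some_iff

namespace IsState

variable {t : E → ℝ}

theorem map_nmul (ht : IsState t) (c : E) :
    ∀ (k : ℕ) (b : E), nmul k c = some b → t b = k * t c
  | 0, b, h => by
    obtain rfl : 0 = b := Option.some.inj h
    simp [ht.map_zero]
  | k + 1, b, h => by
    obtain ⟨a, ha, hb⟩ := nmul_succ_eq_some.1 h
    rw [(ht.map_add _ _ _ hb).2, map_nmul ht c k a ha]
    push_cast
    ring

end IsState

/-! ### Decompositions as index functions -/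

namespace IsDecomposition

variable {n : ℕ} {D : Fin (n + 1) → Set E}

theorem exists_mem (hD : IsDecomposition n D) (x : E) : ∃ i, x ∈ D i :=
  Set.mem_iUnion.1 (hD.cover ▸ Set.mem_univ x)

theorem index_unique (hD : IsDecomposition n D) {i j : Fin (n + 1)} {x : E}
    (hi : x ∈ D i) (hj : x ∈ D j) : i = j := by
  by_contra h
  have hx : x ∈ D i ∩ D j := ⟨hi, hj⟩
  simp [hD.disjoint i j h] at hx

theorem index_add (hD : IsDecomposition n D) {i j k : Fin (n + 1)} {x y z : E}
    (hx : x ∈ D i) (hy : y ∈ D j) (hz : z ∈ D k) (h : padd x y = some z) :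
    (k : ℕ) = i + j := by
  obtain ⟨_, hz'⟩ := hD.add_mem i j x y z hx hy h
  exact congrArg Fin.val (hD.index_unique hz hz')

/-- Since `0 + 0 = 0`, the index `i` of `0` satisfies `i = i + i`. -/
theorem zero_mem (hD : IsDecomposition n D) : (0 : E) ∈ D 0 := by
  obtain ⟨i, hi⟩ := hD.exists_mem 0
  have h := hD.index_add hi hi hi (zero_padd 0)
  obtain rfl : i = 0 := Fin.ext (by simpa using h)
  exact hi

theorem one_mem (hD : IsDecomposition n D) : (1 : E) ∈ D (Fin.last n) := by
  have h : rneg (0 : E) ∈ D (Fin.rev 0) := hD.image_rneg 0 ▸ ⟨0, hD.zero_mem, rfl⟩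
  rwa [rneg_zero, Fin.rev_zero] at h

/-- Every `n`-decomposition with `n ≥ 1` induces a state with value `i / n` on the `i`-th part. -/
theorem exists_state (hn : 1 ≤ n) (hD : IsDecomposition n D) :
    ∃ s : E → ℝ, IsState s ∧ ∀ i, ∀ x ∈ D i, s x = ((i : ℕ) : ℝ) / n := by
  have hn0 : (0 : ℝ) < n := by exact_mod_cast hn
  choose ι hι using hD.exists_mem
  have hval : ∀ i, ∀ x ∈ D i, ((ι x : ℕ) : ℝ) / n = ((i : ℕ) : ℝ) / n := fun i x hx => by
    rw [hD.index_unique (hι x) hx]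
  have hmem : ∀ x, ((ι x : ℕ) : ℝ) / n ∈ Set.Icc (0 : ℝ) 1 := fun x =>
    ⟨by positivity, (div_le_one hn0).2 (by exact_mod_cast Nat.lt_succ_iff.1 (ι x).2)⟩
  have hadd : ∀ a b c : E, padd a b = some c →
      ((ι c : ℕ) : ℝ) / n = ((ι a : ℕ) : ℝ) / n + ((ι b : ℕ) : ℝ) / n := fun a b c h => by
    rw [hD.index_add (hι a) (hι b) (hι c) h]
    push_cast
    ring
  refine ⟨fun x => ((ι x : ℕ) : ℝ) / n, ⟨hmem, ?_, ?_, fun a b c h => ⟨?_, hadd a b c h⟩⟩, hval⟩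
  · simpa using hval 0 0 hD.zero_mem
  · simpa [hn0.ne'] using hval _ 1 hD.one_mem
  · exact (hadd a b c h) ▸ (hmem c).2

end IsDecomposition

/-! ### Values of a state on a perfect decomposition -/

namespace IsPerfectDecomposition

variable {n : ℕ} {D : Fin (n + 1) → Set E} {t : E → ℝ}

/-- All multiples of `x` exist and stay in the ideal `D 0`, because `0 + 0 < n`. Their values `k * t
x` are bounded by `1`, so the Archimedean property gives `t x = 0`. -/
theorem state_eq_zero (hn : 1 ≤ n) (hD : IsPerfectDecomposition n D) (ht : IsState t) {x : E}
    (hx : x ∈ D 0) : t x = 0 := by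
  have key : ∀ k : ℕ, ∃ y ∈ D 0, t y = k * t x := by
    intro k
    induction k with
    | zero => exact ⟨0, hD.decomposition.zero_mem, by simp [ht.map_zero]⟩
    | succ k ih =>
      obtain ⟨y, hy, hty⟩ := ih
      obtain ⟨z, hz⟩ := hD.summable 0 0 y x (by simp; omega) hy hx
      refine ⟨z, hD.maximal.ideal.add y x z hy hx hz, ?_⟩
      rw [(ht.map_add _ _ _ hz).2, hty]
      push_cast
      ring
  refine le_antisymm ?_ (ht.mem_Icc x).1
  by_contra! h
  obtain ⟨k, hk⟩ := exists_nat_gt (1 / t x)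
  obtain ⟨y, -, hy⟩ := key k
  have := (ht.mem_Icc y).2
  rw [div_lt_iff₀ h] at hk
  linarith

/-- Under (RDP)₁ the value of a state at an element below a multiple of `c ∈ D 1` is determined
by the part of the decomposition containing the element. -/
theorem state_eq_of_padd_eq_nmul (hn : 1 ≤ n) (hD : IsPerfectDecomposition n D) (hR : RDP1 E)
    (ht : IsState t) {c : E} {i₁ : Fin (n + 1)} (h1 : (i₁ : ℕ) = 1) (hc : c ∈ D i₁) (k : ℕ) :
    ∀ x y s : E, nmul k c = some s → padd x y = some s →
      ∀ i, x ∈ D i → t x = ((i : ℕ) : ℝ) * t c := by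
  have hd := hD.decomposition
  induction k with
  | zero =>
    intro x y s hs hxy i hx
    obtain rfl : 0 = s := Option.some.inj hs
    obtain ⟨j, hy⟩ := hd.exists_mem y
    have h := hd.index_add hx hy hd.zero_mem hxy
    obtain rfl : i = 0 := Fin.ext (by rw [Fin.val_zero] at h ⊢; omega)
    simp [hD.state_eq_zero hn ht hx]
  | succ k ih =>
    intro x y s hs hxy i hx
    obtain ⟨b, hb, hbc⟩ := nmul_succ_eq_some.1 hs
    -- Refining `x + y = b + c` gives `x = p + q` with `p + r = b`, where the induction hypothesis
    -- applies to `p`, and `q + w = c`.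
    obtain ⟨p, q, r, w, hpq, -, hpr, hqw, -⟩ := hR _ _ _ _ _ hxy hbc
    obtain ⟨ip, hp⟩ := hd.exists_mem p
    obtain ⟨iq, hq⟩ := hd.exists_mem q
    obtain ⟨iw, hw⟩ := hd.exists_mem w
    have hx_idx := hd.index_add hp hq hx hpq
    have hc_idx := hd.index_add hq hw hc hqw
    have htp := ih p r b hb hpr ip hp
    have htq : t q = ((iq : ℕ) : ℝ) * t c := by
      have hsum := (ht.map_add _ _ _ hqw).2
      -- The indices of `q` and `w` add up to `1`, so one of the two lies in `D 0` and has value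
      -- `0`; the other carries all of `t c`.
      rcases Nat.eq_zero_or_pos (iq : ℕ) with h0 | h0
      · obtain rfl : iq = 0 := Fin.ext h0
        simp [hD.state_eq_zero hn ht hq]
      · obtain rfl : iw = 0 := Fin.ext (by rw [Fin.val_zero]; omega)
        have hq1 : (iq : ℕ) = 1 := by simp at hc_idx; omega
        rw [hD.state_eq_zero hn ht hw] at hsum
        rw [hq1, hsum]
        simp
    rw [(ht.map_add _ _ _ hpq).2, htp, htq, hx_idx]
    push_cast
    ring

theorem state_eq (hn : 1 ≤ n) (hD : IsPerfectDecomposition n D) (hR : RDP1 E)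
    (ht : IsState t) {c : E} {i₁ : Fin (n + 1)} (h1 : (i₁ : ℕ) = 1) (hc : c ∈ D i₁)
    (hnc : nmul n c = some 1) {i : Fin (n + 1)} {x : E} (hx : x ∈ D i) :
    t x = ((i : ℕ) : ℝ) / n := by
  have hn0 : (n : ℝ) ≠ 0 := by exact_mod_cast (by omega : n ≠ 0)
  have htc := ht.map_nmul c n 1 hnc
  rw [ht.map_one] at htc
  rw [hD.state_eq_of_padd_eq_nmul hn hR ht h1 hc n x (rneg x) 1 hnc (padd_rneg x) i hx,
    eq_div_iff hn0, mul_assoc, mul_comm (t c), ← htc, mul_one]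

end IsPerfectDecomposition

theorem IsState.isExtremal_of_unique {s : E → ℝ} (hs : IsState s)
    (h : ∀ t : E → ℝ, IsState t → t = s) : IsExtremal s :=
  ⟨hs, fun s₁ s₂ _ h₁ h₂ _ _ => ⟨(h s₁ h₁).symm, (h s₂ h₂).symm⟩⟩

/-! ### Arguments inside the representing group -/

namespace IsIso

variable {H : UnitalPoGroup.{u}} {φ : E → H.Gamma}

theorem padd_eq_some_iff (hφ : IsIso φ) {a b c : E} :
    padd a b = some c ↔ (φ a).1 + (φ b).1 = (φ c).1 :=
  (hφ.map_padd a b c).trans (UnitalPoGroup.Gamma.padd_eq_some _ _ _)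

theorem coe_map_zero (hφ : IsIso φ) : (φ 0).1 = 0 := congrArg Subtype.val hφ.map_zero

theorem coe_map_nmul (hφ : IsIso φ) (c : E) :
    ∀ (k : ℕ) (b : E), nmul k c = some b → (φ b).1 = k • (φ c).1
  | 0, b, h => by
    obtain rfl : 0 = b := Option.some.inj h
    rw [hφ.coe_map_zero, zero_nsmul]
  | k + 1, b, h => by
    obtain ⟨a, ha, hb⟩ := nmul_succ_eq_some.1 h
    rw [succ_nsmul, ← coe_map_nmul hφ c k a ha, hφ.padd_eq_some_iff.1 hb]

end IsIso

/-- As `c` is central in `H`, `n (d - c) = n d - n c = 0`, and torsion-freeness gives `d = c`.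
Commutation of `d` with other elements is not needed. -/
theorem IsStrongCyclic.eq_of_nmul_eq_one {n : ℕ} (hn : 1 ≤ n) {c d : E}
    (hc : IsStrongCyclic n c) (hd : nmul n d = some 1) : d = c := by
  obtain ⟨H, φ, hH, hφ, -, hnc, hcomm⟩ := hc
  have hcd : AddCommute (φ d).1 (-(φ c).1) := AddCommute.neg_right (hcomm _)
  have h0 : n • ((φ d).1 + -(φ c).1) = 0 := by
    rw [hcd.add_nsmul, neg_nsmul, ← hφ.coe_map_nmul c n 1 hnc, ← hφ.coe_map_nmul d n 1 hd,
      add_neg_cancel]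
  refine hφ.bijective.1 (Subtype.ext ?_)
  by_contra hne
  refine hH ((φ d).1 + -(φ c).1) n (fun h => hne (add_neg_eq_zero.1 h)) (by omega) ?_
  rw [natCast_zsmul, h0]

/-- The unit `u = n c` is a multiple of a central element, so left and right complements with
respect to `u` agree. -/
theorem IsStrongCyclic.isSymmetric {n : ℕ} {c : E} (hc : IsStrongCyclic n c) :
    IsSymmetric E := by
  obtain ⟨H, φ, -, hφ, -, hnc, hcomm⟩ := hc
  intro a
  have hu : AddCommute (φ a).1 (φ 1).1 := by
    rw [hφ.coe_map_nmul c n 1 hnc]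
    exact AddCommute.nsmul_right (hcomm _) n
  have h := hφ.padd_eq_some_iff.1 (lneg_padd a)
  -- In `H`, `a + a⁻ + a = a + u = u + a`; cancelling `a` on the right leaves `a + a⁻ = u`.
  refine eq_rneg (hφ.padd_eq_some_iff.2 (add_right_cancel (b := (φ a).1) ?_))
  rw [add_assoc, h, hu.eq]

end PseudoEffectAlgebra

theorem corollary6p8 {E : Type u} [PseudoEffectAlgebra E] (n : ℕ) (hn : 1 ≤ n)
    (hE : PseudoEffectAlgebra.IsStrongPerfect E n) :
    (∃! c : E, PseudoEffectAlgebra.IsStrongCyclic n c) ∧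
    (∃! D : Fin (n + 1) → Set E, PseudoEffectAlgebra.IsDecomposition n D) ∧
    (∀ D : Fin (n + 1) → Set E, PseudoEffectAlgebra.IsDecomposition n D →
      ∃ s : E → ℝ, PseudoEffectAlgebra.IsState s ∧
        (∀ i : Fin (n + 1), s '' D i = {((i : ℕ) : ℝ) / (n : ℝ)}) ∧
        (∀ t : E → ℝ, PseudoEffectAlgebra.IsState t → t = s) ∧
        PseudoEffectAlgebra.IsExtremal s) ∧
    PseudoEffectAlgebra.IsSymmetric E := by
  obtain ⟨-, hR, c, hc⟩ := hE
  have hn0 : (n : ℝ) ≠ 0 := by exact_mod_cast (by omega : n ≠ 0)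
  obtain ⟨D, i₁, hD, h1, hcD⟩ : ∃ (D : Fin (n + 1) → Set E) (i : Fin (n + 1)),
      PseudoEffectAlgebra.IsPerfectDecomposition n D ∧ (i : ℕ) = 1 ∧ c ∈ D i := by
    obtain ⟨_, _, _, _, h, _⟩ := hc
    exact h
  have hnc : PseudoEffectAlgebra.nmul n c = some 1 := by
    obtain ⟨_, _, _, _, _, h, _⟩ := hc
    exact h
  have hstate : ∀ s t : E → ℝ, PseudoEffectAlgebra.IsState s →
      PseudoEffectAlgebra.IsState t → t = s := by
    intro s t hs ht
    funext x
    obtain ⟨i, hx⟩ := hD.decomposition.exists_mem x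
    rw [hD.state_eq hn hR hs h1 hcD hnc hx, hD.state_eq hn hR ht h1 hcD hnc hx]
  refine ⟨⟨c, hc, ?_⟩, ⟨D, hD.decomposition, ?_⟩, ?_, hc.isSymmetric⟩
  · rintro d ⟨_, _, _, _, _, hnd, _⟩
    exact hc.eq_of_nmul_eq_one hn hnd
  · intro D' hD'
    obtain ⟨s, hs, hsD⟩ := hD'.exists_state hn
    -- The state built from `D'` takes the value `j / n` on `D' j`, but like every state it takes `i
    -- / n` on `D i`.
    have hidx : ∀ {i j : Fin (n + 1)} {x : E}, x ∈ D i → x ∈ D' j → i = j := by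
      intro i j x hi hj
      have h := (hD.state_eq hn hR hs h1 hcD hnc hi).symm.trans (hsD j x hj)
      rw [div_left_inj' hn0] at h
      exact Fin.ext (by exact_mod_cast h)
    funext i
    ext x
    constructor
    · intro hx
      obtain ⟨j, hj⟩ := hD.decomposition.exists_mem x
      exact hidx hj hx ▸ hj
    · intro hx
      obtain ⟨j, hj⟩ := hD'.exists_mem x
      exact hidx hx hj ▸ hj
  · intro D' hD'
    obtain ⟨s, hs, hsD⟩ := hD'.exists_state hn
    have hu : ∀ t : E → ℝ, PseudoEffectAlgebra.IsState t → t = s := fun t => hstate s t hs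
    refine ⟨s, hs, fun i => ?_, hu, hs.isExtremal_of_unique hu⟩
    exact Set.eq_singleton_iff_nonempty_unique_mem.2
      ⟨(hD'.nonempty i).image s, by rintro _ ⟨x, hx, rfl⟩; exact hsD i x hx⟩
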